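/- Let $\eta(\tau)=e^{\pi i\tau/12}\prod_{n\ge1}(1-e^{2\pi i n\tau})$ ($\operatorname{Im}\tau>0$) be the Dedekind eta function, let $\varphi$ be Euler's totient function and $\mu$ the Möbius function. For every positive integer $N$, the eta product $$S_N(\tau)=\frac{\eta(N\tau)^{\varphi(N)}}{\prod_{d\mid N}\eta(d\tau)^{\mu(d)}}$$ has nonnegative Fourier coefficients; that is, its Fourier expansion has the form $$S_N(\tau)=\sum_{m\ge0}c_m\,e^{2\pi i m\tau/24}\qquad(\operatorname{Im}\tau>0),$$ with real coefficients $c_m\ge0$ for all $m\ge0$. -/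

import Mathlib

open scoped UpperHalfPlane

/-- The eta product `S_N(τ) = η(Nτ)^{φ(N)} / ∏_{d ∣ N} η(dτ)^{μ(d)}` on the upper half plane,
where `η` is the Dedekind eta function, `φ` Euler's totient function and `μ` the (integer-valued)
Möbius function. -/
noncomputable def saitoEtaProduct (N : ℕ) (τ : ℍ) : ℂ :=
  ModularForm.eta ((N : ℂ) * (τ : ℂ)) ^ Nat.totient N /
    ∏ d ∈ N.divisors, ModularForm.eta ((d : ℂ) * (τ : ℂ)) ^ (ArithmeticFunction.moebius d : ℤ)

/-! ### q-Pochhammer products and theta functions -/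

open Filter Topology

/-! Up to a power of `e^{2πiτ/24}`, the eta product is `etaSeries N` at `q = e^{2πiτ}`. Positivity
is encoded as being a sum of monomials `q ^ m i` over one index family for all `q`; this is stable
under products and `q ↦ q ^ n`.

The engine is `IsPosLaurent₂.exists_eq_mul_theta`: a sum of monomials in `q` and `w` with the
quasi-periodicity of a theta function is that theta function times its constant term in `w`, and
that constant term is again a sum of monomials. Products of theta functions are such sums by the
Jacobi triple product. This yields two positive families: the `k`-core series `(q^k;q^k)^k/(q;q)`
(`isPosLaurent_core`) and quotients of theta functions (`isPosLaurent_theta_quotient`).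

Induct on `N = pM`, `p` the least prime factor. If `p ∣ M`, then `etaSeries N` is `etaSeries M`
times a power of the `p`-core series in `q^M`. Otherwise `M` is odd; the Möbius product over
divisors of `M` runs over residues prime to `M`, and pairing `a` with `M - a` factors `etaSeries N`
into theta quotients (a `p`-core series if `M = 1`). Boundedness at the cusp finally excludes
negative exponents. -/

/-- The infinite `q`-Pochhammer symbol `(z; q)_∞ = ∏_{n ≥ 0} (1 - z q ^ n)`. -/
noncomputable def qPoch (z q : ℂ) : ℂ := ∏' n : ℕ, (1 - z * q ^ n)

lemma summable_norm_mul_pow (z : ℂ) {q : ℂ} (hq : ‖q‖ < 1) :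
    Summable fun n : ℕ ↦ ‖-(z * q ^ n)‖ := by
  simpa using (summable_geometric_of_lt_one (norm_nonneg _) hq).mul_left ‖z‖

lemma multipliable_qPoch (z : ℂ) {q : ℂ} (hq : ‖q‖ < 1) :
    Multipliable fun n : ℕ ↦ 1 - z * q ^ n := by
  simpa [sub_eq_add_neg] using multipliable_one_add_of_summable (summable_norm_mul_pow z hq)

lemma qPoch_ne_zero {z q : ℂ} (hq : ‖q‖ < 1) (h : ∀ n : ℕ, z * q ^ n ≠ 1) :
    qPoch z q ≠ 0 := by
  have := tprod_one_add_ne_zero_of_summable (f := fun n : ℕ ↦ -(z * q ^ n))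
    (fun n ↦ by simpa [← sub_eq_add_neg, sub_eq_zero] using (h n).symm)
    (summable_norm_mul_pow z hq)
  simpa [qPoch, sub_eq_add_neg] using this

lemma qPoch_ne_zero_of_norm_lt_one {z q : ℂ} (hq : ‖q‖ < 1) (hz : ‖z‖ < 1) :
    qPoch z q ≠ 0 := by
  refine qPoch_ne_zero hq fun n h ↦ ?_
  have h1 : ‖z * q ^ n‖ < 1 := by
    rw [norm_mul, norm_pow]
    exact mul_lt_one_of_nonneg_of_lt_one_left (norm_nonneg _) hz
      (pow_le_one₀ (norm_nonneg _) hq.le)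
  simp [h] at h1

lemma qPoch_eq_one_sub_mul (z : ℂ) {q : ℂ} (hq : ‖q‖ < 1) :
    qPoch z q = (1 - z) * qPoch (z * q) q := by
  have h := (multipliable_qPoch (z * q) hq)
  unfold qPoch
  rw [tprod_eq_zero_mul' (by simpa [pow_succ', mul_assoc] using h)]
  simp [pow_succ', mul_assoc]

lemma tendsto_qPoch (z : ℂ) {q : ℂ} (hq : ‖q‖ < 1) :
    Tendsto (fun n ↦ ∏ i ∈ Finset.range n, (1 - z * q ^ i)) atTop (𝓝 (qPoch z q)) :=
  (multipliable_qPoch z hq).hasProd.tendsto_prod_nat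

/-- Splitting the factors of `(z; q)_∞` according to residues modulo `k`. -/
lemma qPoch_eq_prod_range (z : ℂ) {q : ℂ} (hq : ‖q‖ < 1) {k : ℕ} (hk : 0 < k) :
    qPoch z q = ∏ i ∈ Finset.range k, qPoch (z * q ^ i) (q ^ k) := by
  have hqk : ‖q ^ k‖ < 1 := by
    rw [norm_pow]; exact pow_lt_one₀ (norm_nonneg _) hq hk.ne'
  have h1 := (tendsto_qPoch z hq).comp (tendsto_id.nsmul_atTop hk)
  have h2 := tendsto_finsetProd (Finset.range k) fun i _ ↦ tendsto_qPoch (z * q ^ i) hqk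
  refine tendsto_nhds_unique h1 (h2.congr fun n ↦ ?_)
  simp only [Function.comp, id, smul_eq_mul]
  induction n with
  | zero => simp
  | succ n ih =>
    simp only [Finset.prod_range_succ, Finset.prod_mul_distrib]
    rw [ih, mul_add, mul_one, Finset.prod_range_add]
    congr 1
    refine Finset.prod_congr rfl fun i _ ↦ ?_
    ring_nf

/-- The theta function in product form. -/
noncomputable def theta (z q : ℂ) : ℂ := qPoch z q * qPoch (q / z) q * qPoch q q

/-- The first product loses the factor `1 - z`, the second gains `1 - z⁻¹ = -z⁻¹ (1 - z)`. -/
lemma theta_mul_base {z q : ℂ} (hq : ‖q‖ < 1) (hq0 : q ≠ 0) (hz : z ≠ 0) :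
    theta (z * q) q = -z⁻¹ * theta z q := by
  have h1 := qPoch_eq_one_sub_mul z hq
  have h2 := qPoch_eq_one_sub_mul (q / (z * q)) hq
  have h3 : q / (z * q) * q = q / z := by field_simp
  rw [h3] at h2
  unfold theta
  rw [h1, h2]
  field_simp
  ring

lemma theta_one {q : ℂ} (hq : ‖q‖ < 1) : theta 1 q = 0 := by
  simp [theta, qPoch_eq_one_sub_mul 1 hq]

/-! ### The Jacobi triple product -/

/-- The triangular numbers, extended to the integers. -/
def tri (n : ℤ) : ℤ := n * (n - 1) / 2

lemma two_mul_tri (n : ℤ) : 2 * tri n = n * (n - 1) :=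
  Int.mul_ediv_cancel' (Int.even_mul_pred_self n).two_dvd

lemma tri_add_one (n : ℤ) : tri (n + 1) = tri n + n := by
  have h1 := two_mul_tri n
  have h2 := two_mul_tri (n + 1)
  linarith

lemma tri_neg (n : ℤ) : tri (-n) = tri n + n := by
  have h1 := two_mul_tri n
  have h2 := two_mul_tri (-n)
  linarith

@[simp] lemma tri_zero : tri 0 = 0 := rfl

lemma summable_nat_theta {z q : ℂ} (hz : z ≠ 0) (hq0 : q ≠ 0) (hq : ‖q‖ < 1) :
    Summable fun n : ℕ ↦ z ^ (n : ℤ) * q ^ tri n := by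
  refine summable_of_ratio_test_tendsto_lt_one zero_lt_one
    (.of_forall fun n ↦ mul_ne_zero (zpow_ne_zero _ hz) (zpow_ne_zero _ hq0)) ?_
  have h := (tendsto_pow_atTop_nhds_zero_of_lt_one (norm_nonneg q) hq).const_mul ‖z‖
  rw [mul_zero] at h
  refine h.congr fun n ↦ ?_
  have e : z ^ ((n + 1 : ℕ) : ℤ) * q ^ tri ((n + 1 : ℕ) : ℤ)
      = (z * q ^ n) * (z ^ (n : ℤ) * q ^ tri n) := by
    push_cast
    rw [tri_add_one, zpow_add₀ hz, zpow_add₀ hq0, zpow_natCast q, zpow_one]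
    ring
  rw [e, norm_mul, mul_div_cancel_right₀]
  · simp
  · exact norm_ne_zero_iff.2 (mul_ne_zero (zpow_ne_zero _ hz) (zpow_ne_zero _ hq0))

lemma summable_theta {z q : ℂ} (hz : z ≠ 0) (hq0 : q ≠ 0) (hq : ‖q‖ < 1) :
    Summable fun n : ℤ ↦ z ^ n * q ^ tri n := by
  refine Summable.of_nat_of_neg (summable_nat_theta hz hq0 hq) ?_
  refine (summable_nat_theta (z := z⁻¹ * q) (mul_ne_zero (inv_ne_zero hz) hq0) hq0 hq).congr
    fun n ↦ ?_
  rw [tri_neg, zpow_add₀ hq0, mul_zpow, inv_zpow', mul_assoc, mul_comm (q ^ (n : ℤ))]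

/-- The finite `q`-Pochhammer symbol `(q; q)_n`. -/
noncomputable def qFac (q : ℂ) (n : ℕ) : ℂ := ∏ i ∈ Finset.range n, (1 - q * q ^ i)

/-- `1 / (q; q)_n`, extended by zero to negative `n`. -/
noncomputable def qFacInv (q : ℂ) : ℤ → ℂ
  | Int.ofNat n => (qFac q n)⁻¹
  | Int.negSucc _ => 0

lemma one_sub_mul_pow_ne_zero {q : ℂ} (hq : ‖q‖ < 1) (n : ℕ) : 1 - q * q ^ n ≠ 0 := by
  intro h
  have h2 : ‖q ^ (n + 1)‖ < 1 := by
    rw [norm_pow]; exact pow_lt_one₀ (norm_nonneg _) hq (by simp)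
  rw [pow_succ', ← sub_eq_zero.1 h] at h2
  simp at h2

/-- At `m = 0` the factor `1 - q ^ 0` vanishes, in accord with the extension by zero, so the finite
triple product needs no boundary cases. -/
lemma qFacInv_sub_one {q : ℂ} (hq : ‖q‖ < 1) (m : ℤ) :
    qFacInv q (m - 1) = (1 - q ^ m) * qFacInv q m := by
  rcases m with (_ | n) | n
  · simp only [Int.ofNat_eq_natCast, Nat.cast_zero, zpow_zero, sub_self, zero_mul]
    rfl
  · have h : (Int.ofNat (n + 1) : ℤ) - 1 = Int.ofNat n := by simp
    rw [h]
    have h1 := one_sub_mul_pow_ne_zero hq n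
    have h2 : q ^ (Int.ofNat (n + 1)) = q * q ^ n := by
      rw [Int.ofNat_eq_natCast, zpow_natCast, pow_succ']
    rw [h2]
    simp only [qFacInv]
    rw [qFac, qFac, Finset.prod_range_succ]
    field_simp
  · have h : (Int.negSucc n : ℤ) - 1 = Int.negSucc (n + 1) := rfl
    rw [h]
    simp [qFacInv]

/-- The finite form of the Jacobi triple product. -/
lemma hasSum_finite_triple_product {z q : ℂ} (hz : z ≠ 0) (hq0 : q ≠ 0) (hq : ‖q‖ < 1) (n : ℕ) :
    HasSum (fun j : ℤ ↦ (-z) ^ j * q ^ tri j * (qFac q (2 * n) * qFacInv q (n + j) *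
        qFacInv q (n - j)))
      (∏ i ∈ Finset.range n, ((1 - z * q ^ i) * (1 - q / z * q ^ i))) := by
  induction n with
  | zero =>
    rw [Finset.prod_range_zero]
    convert hasSum_ite_eq (0 : ℤ) (1 : ℂ) using 2 with j
    rcases lt_trichotomy j 0 with h | h | h
    · obtain ⟨k, rfl⟩ := Int.eq_negSucc_of_lt_zero h
      simp [qFacInv]
    · subst h
      simp [qFacInv, qFac]
    · obtain ⟨k, hk⟩ := Int.eq_negSucc_of_lt_zero (by omega : -j < 0)
      have : qFacInv q (-j) = 0 := by rw [hk]; rfl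
      simp [this, h.ne']
  | succ n ih =>
    set f : ℤ → ℂ := fun j : ℤ ↦ (-z) ^ j * q ^ tri j * (qFac q (2 * n) * qFacInv q (n + j) *
        qFacInv q (n - j)) with hf
    -- The new factor expands as `1 + q^(2n+1) - z q^n - z⁻¹ q^(n+1)`, so the next sum combines the
    -- old one with its two shifts in `j`.
    have h1 := (((Equiv.subRight (1 : ℤ)).hasSum_iff.2 ih).mul_left (-z * q ^ n))
    have h2 := (((Equiv.addRight (1 : ℤ)).hasSum_iff.2 ih).mul_left (-z⁻¹ * q ^ (n + 1)))
    have h3 := ih.mul_left (1 + q ^ (2 * n + 1))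
    convert (h1.add h2).add h3 using 1
    · rfl
    · funext j
      have hz' : -z ≠ 0 := neg_ne_zero.2 hz
      simp only [Function.comp, Equiv.subRight_apply, Equiv.coe_addRight, hf]
      have e1 : tri (j - 1) = tri j - (j - 1) := by
        have := tri_add_one (j - 1); simp at this; linarith
      rw [e1, tri_add_one, zpow_add₀ hz', zpow_sub₀ hz', zpow_one, zpow_sub₀ hq0 (tri j),
        zpow_sub₀ hq0 j, zpow_add₀ hq0 (tri j), zpow_one]
      push_cast
      have r1 := qFacInv_sub_one hq (n + 1 + j)
      have r2 := qFacInv_sub_one hq (n + j)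
      have r3 := qFacInv_sub_one hq (n + 1 - j)
      have r4 := qFacInv_sub_one hq (n - j)
      rw [show (n + 1 + j : ℤ) - 1 = n + j by ring] at r1
      rw [show (n + 1 - j : ℤ) - 1 = n - j by ring] at r3
      rw [show (n + (j - 1) : ℤ) = n + j - 1 by ring, show (n - (j - 1) : ℤ) = n + 1 - j by ring,
        show (n + (j + 1) : ℤ) = n + 1 + j by ring, show (n - (j + 1) : ℤ) = n - j - 1 by ring,
        r2, r4, r1, r3]
      have e2 : qFac q (2 * (n + 1)) = qFac q (2 * n) * (1 - q ^ (2 * n + 1)) *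
          (1 - q ^ (2 * n + 2)) := by
        rw [qFac, mul_add, mul_one, Finset.prod_range_succ, Finset.prod_range_succ, qFac]
        ring
      rw [e2]
      have e3 : q ^ ((n : ℤ) + 1 + j) = q ^ n * q * q ^ j := by
        rw [zpow_add₀ hq0, zpow_add₀ hq0, zpow_natCast, zpow_one]
      have e4 : q ^ ((n : ℤ) + 1 - j) = q ^ n * q / q ^ j := by
        rw [zpow_sub₀ hq0, zpow_add₀ hq0, zpow_natCast, zpow_one]
      have e5 : q ^ ((n : ℤ) + j) = q ^ n * q ^ j := by
        rw [zpow_add₀ hq0, zpow_natCast]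
      have e6 : q ^ ((n : ℤ) - j) = q ^ n / q ^ j := by
        rw [zpow_sub₀ hq0, zpow_natCast]
      rw [e3, e4, e5, e6]
      have hqj : q ^ j ≠ 0 := zpow_ne_zero _ hq0
      generalize q ^ j = y at *
      field_simp
      ring
    · rw [Finset.prod_range_succ]
      field_simp
      ring_nf

lemma tendsto_qFacInv {q : ℂ} (hq : ‖q‖ < 1) (j : ℤ) (s : ℤ) (hs : s = 1 ∨ s = -1) :
    Tendsto (fun n : ℕ ↦ qFacInv q (n + s * j)) atTop (𝓝 (qPoch q q)⁻¹) := by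
  have h0 : Tendsto (fun n : ℕ ↦ (qFac q n)⁻¹) atTop (𝓝 (qPoch q q)⁻¹) :=
    (tendsto_qPoch q hq).inv₀ (qPoch_ne_zero_of_norm_lt_one hq hq)
  have h1 : Tendsto (fun n : ℕ ↦ ((n : ℤ) + s * j).toNat) atTop atTop := by
    refine tendsto_atTop.2 fun b ↦ ?_
    filter_upwards [eventually_ge_atTop (b + j.natAbs)] with n hn
    rcases hs with rfl | rfl <;> omega
  refine (h0.comp h1).congr' ?_
  filter_upwards [eventually_ge_atTop j.natAbs] with n hn
  have h2 : 0 ≤ (n : ℤ) + s * j := by rcases hs with rfl | rfl <;> omega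
  conv_rhs => rw [← Int.toNat_of_nonneg h2]
  rfl

/-- The Jacobi triple product identity. -/
theorem hasSum_theta {z q : ℂ} (hz : z ≠ 0) (hq0 : q ≠ 0) (hq : ‖q‖ < 1) :
    HasSum (fun j : ℤ ↦ (-z) ^ j * q ^ tri j) (theta z q) := by
  have hE := qPoch_ne_zero_of_norm_lt_one hq hq
  obtain ⟨A, hA⟩ : ∃ A, ∀ n, ‖qFac q n‖ ≤ A := by
    obtain ⟨A, hA⟩ := (tendsto_qPoch q hq).norm.bddAbove_range
    exact ⟨A, fun n ↦ hA ⟨n, rfl⟩⟩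
  obtain ⟨B, hB0, hB⟩ : ∃ B, 0 ≤ B ∧ ∀ m, ‖qFacInv q m‖ ≤ B := by
    obtain ⟨B, hB⟩ := ((tendsto_qPoch q hq).inv₀ hE).norm.bddAbove_range
    have hB' : ∀ n : ℕ, ‖qFacInv q (Int.ofNat n)‖ ≤ B := fun n ↦ hB ⟨n, rfl⟩
    have hB0 := (norm_nonneg _).trans (hB' 0)
    refine ⟨B, hB0, fun m ↦ ?_⟩
    rcases m with n | n
    · exact hB' n
    · simpa [qFacInv] using hB0
  have hA0 := (norm_nonneg _).trans (hA 0)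
  have hs := summable_theta (neg_ne_zero.2 hz) hq0 hq
  -- Let `n → ∞` in the finite identity: the `q`-binomial factor is at most `A * B * B`, uniformly
  -- in `n` and `j`.
  have hlim := tendsto_tsum_of_dominated_convergence (𝓕 := atTop)
    (f := fun (n : ℕ) (j : ℤ) ↦ (-z) ^ j * q ^ tri j * (qFac q (2 * n) * qFacInv q (n + j) *
        qFacInv q (n - j)))
    (g := fun j ↦ (-z) ^ j * q ^ tri j * (qPoch q q * (qPoch q q)⁻¹ * (qPoch q q)⁻¹))
    (hs.norm.mul_right (A * B * B)) (fun j ↦ ?_) (.of_forall fun n j ↦ ?_)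
  · have h1 : Tendsto (fun n : ℕ ↦ ∏ i ∈ Finset.range n,
        ((1 - z * q ^ i) * (1 - q / z * q ^ i))) atTop (𝓝 (qPoch z q * qPoch (q / z) q)) := by
      simp only [Finset.prod_mul_distrib]
      exact (tendsto_qPoch z hq).mul (tendsto_qPoch (q / z) hq)
    have h2 := tendsto_nhds_unique h1 (hlim.congr fun n ↦
      (hasSum_finite_triple_product hz hq0 hq n).tsum_eq)
    rw [tsum_mul_right, mul_inv_cancel₀ hE, one_mul] at h2
    have h3 : theta z q = ∑' j : ℤ, (-z) ^ j * q ^ tri j := by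
      rw [theta, h2]; field_simp
    rw [h3]
    exact hs.hasSum
  · refine Tendsto.const_mul _ ((Tendsto.mul ?_ ?_).mul ?_)
    · exact (tendsto_qPoch q hq).comp (tendsto_id.const_mul_atTop' two_pos)
    · simpa using tendsto_qFacInv hq j 1 (.inl rfl)
    · simpa [sub_eq_add_neg] using tendsto_qFacInv hq j (-1) (.inr rfl)
  · rw [norm_mul, norm_mul (_ * _), norm_mul (qFac _ _)]
    gcongr <;> first | exact hA _ | exact hB _

lemma Complex.hasSum_mul {ι κ : Type*} {f : ι → ℂ} {g : κ → ℂ} {a b : ℂ} (hf : HasSum f a)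
    (hg : HasSum g b) : HasSum (fun x : ι × κ ↦ f x.1 * g x.2) (a * b) :=
  hf.mul hg (summable_mul_of_summable_norm hf.summable.norm hg.summable.norm)

/-! ### Laurent expansions with nonnegative coefficients -/

/-- `f` is, on the punctured unit disc, a (possibly infinite) sum of integral powers of the
variable. -/
def IsPosLaurent (f : ℂ → ℂ) : Prop :=
  ∃ (ι : Type) (m : ι → ℤ), ∀ q : ℂ, q ≠ 0 → ‖q‖ < 1 → HasSum (fun i ↦ q ^ m i) (f q)

namespace IsPosLaurent

variable {f g : ℂ → ℂ}

lemma congr (hf : IsPosLaurent f) (h : ∀ q : ℂ, q ≠ 0 → ‖q‖ < 1 → f q = g q) :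
    IsPosLaurent g := by
  obtain ⟨ι, m, hm⟩ := hf
  exact ⟨ι, m, fun q h0 h1 ↦ h q h0 h1 ▸ hm q h0 h1⟩

lemma zpow (n : ℤ) : IsPosLaurent fun q ↦ q ^ n :=
  ⟨Unit, fun _ ↦ n, fun _ _ _ ↦ hasSum_unique _⟩

lemma one : IsPosLaurent fun _ ↦ 1 :=
  (zpow 0).congr fun _ _ _ ↦ zpow_zero _

lemma mul (hf : IsPosLaurent f) (hg : IsPosLaurent g) : IsPosLaurent fun q ↦ f q * g q := by
  obtain ⟨ι, m, hm⟩ := hf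
  obtain ⟨κ, n, hn⟩ := hg
  refine ⟨ι × κ, fun x ↦ m x.1 + n x.2, fun q h0 h1 ↦ ?_⟩
  have hm := hm q h0 h1
  have hn := hn q h0 h1
  simpa only [zpow_add₀ h0] using Complex.hasSum_mul hm hn

lemma pow (hf : IsPosLaurent f) (n : ℕ) : IsPosLaurent fun q ↦ f q ^ n := by
  induction n with
  | zero => simpa using one
  | succ n ih => simpa only [pow_succ] using ih.mul hf

lemma prod {α : Type*} (s : Finset α) {f : α → ℂ → ℂ} (hf : ∀ a ∈ s, IsPosLaurent (f a)) :
    IsPosLaurent fun q ↦ ∏ a ∈ s, f a q := by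
  classical
  induction s using Finset.induction_on with
  | empty => simpa using one
  | insert a s ha ih =>
    simp only [Finset.prod_insert ha]
    exact (hf a (by simp)).mul (ih fun b hb ↦ hf b (by simp [hb]))

lemma comp_pow (hf : IsPosLaurent f) {n : ℕ} (hn : n ≠ 0) : IsPosLaurent fun q ↦ f (q ^ n) := by
  obtain ⟨ι, m, hm⟩ := hf
  refine ⟨ι, fun i ↦ n * m i, fun q h0 h1 ↦ ?_⟩
  have := hm (q ^ n) (pow_ne_zero _ h0) (by
    rw [norm_pow]; exact pow_lt_one₀ (norm_nonneg _) h1 hn)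
  simpa only [zpow_mul, zpow_natCast] using this

end IsPosLaurent

/-! ### Two-variable expansions and their constant term -/

/-- `f` is a (possibly infinite) sum of Laurent monomials in `q` and `w`, for `q` in the
punctured unit disc and `w ≠ 0`. -/
def IsPosLaurent₂ (f : ℂ → ℂ → ℂ) : Prop :=
  ∃ (ι : Type) (k m : ι → ℤ), ∀ q w : ℂ, q ≠ 0 → ‖q‖ < 1 → w ≠ 0 →
    HasSum (fun i ↦ w ^ k i * q ^ m i) (f q w)

namespace IsPosLaurent₂

variable {f g : ℂ → ℂ → ℂ}

lemma of_isPosLaurent {f : ℂ → ℂ} (hf : IsPosLaurent f) : IsPosLaurent₂ fun q _ ↦ f q := by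
  obtain ⟨ι, m, hm⟩ := hf
  exact ⟨ι, fun _ ↦ 0, m, fun q w h0 h1 _ ↦ by simpa using hm q h0 h1⟩

lemma mul (hf : IsPosLaurent₂ f) (hg : IsPosLaurent₂ g) :
    IsPosLaurent₂ fun q w ↦ f q w * g q w := by
  obtain ⟨ι, k, m, hm⟩ := hf
  obtain ⟨κ, l, n, hn⟩ := hg
  refine ⟨ι × κ, fun x ↦ k x.1 + l x.2, fun x ↦ m x.1 + n x.2, fun q w h0 h1 hw ↦ ?_⟩
  have hm := hm q w h0 h1 hw
  have hn := hn q w h0 h1 hw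
  simpa only [zpow_add₀ h0, zpow_add₀ hw, mul_mul_mul_comm] using Complex.hasSum_mul hm hn

lemma add (hf : IsPosLaurent₂ f) (hg : IsPosLaurent₂ g) :
    IsPosLaurent₂ fun q w ↦ f q w + g q w := by
  obtain ⟨ι, k, m, hm⟩ := hf
  obtain ⟨κ, l, n, hn⟩ := hg
  exact ⟨ι ⊕ κ, Sum.elim k l, Sum.elim m n, fun q w h0 h1 hw ↦
    HasSum.sum (hm q w h0 h1 hw) (hn q w h0 h1 hw)⟩

lemma prod {α : Type*} (s : Finset α) {f : α → ℂ → ℂ → ℂ} (hf : ∀ a ∈ s, IsPosLaurent₂ (f a)) :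
    IsPosLaurent₂ fun q w ↦ ∏ a ∈ s, f a q w := by
  classical
  induction s using Finset.induction_on with
  | empty => simpa using of_isPosLaurent .one
  | insert a s ha ih =>
    simp only [Finset.prod_insert ha]
    exact (hf a (by simp)).mul (ih fun b hb ↦ hf b (by simp [hb]))

lemma sum {α : Type*} (s : Finset α) {f : α → ℂ → ℂ → ℂ} (hf : ∀ a ∈ s, IsPosLaurent₂ (f a)) :
    IsPosLaurent₂ fun q w ↦ ∑ a ∈ s, f a q w := by
  classical
  induction s using Finset.induction_on with
  | empty => exact ⟨Empty, Empty.elim, Empty.elim, fun _ _ _ _ _ ↦ by simp⟩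
  | insert a s ha ih =>
    simp only [Finset.sum_insert ha]
    exact (hf a (by simp)).add (ih fun b hb ↦ hf b (by simp [hb]))

/-- The sign in `-w` cancels the one in the triple product, leaving all coefficients equal to 1. -/
lemma theta (a M : ℕ) (hM : M ≠ 0) :
    IsPosLaurent₂ fun q w ↦ theta (-w * q ^ a) (q ^ M) := by
  refine ⟨ℤ, fun n ↦ n, fun n ↦ a * n + M * tri n, fun q w h0 h1 hw ↦ ?_⟩
  have h := hasSum_theta (z := -w * q ^ a) (q := q ^ M)
    (mul_ne_zero (neg_ne_zero.2 hw) (pow_ne_zero _ h0)) (pow_ne_zero _ h0)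
    (by rw [norm_pow]; exact pow_lt_one₀ (norm_nonneg _) h1 hM)
  refine h.congr_fun fun n ↦ ?_
  rw [neg_mul, neg_neg, mul_zpow, zpow_add₀ h0, zpow_mul, zpow_mul, zpow_natCast, zpow_natCast]
  ring

end IsPosLaurent₂

open AddCircle in
/-- Uniqueness of Laurent coefficients. -/
lemma eq_zero_of_hasSum_zpow_zero {c : ℤ → ℂ}
    (h : ∀ w : ℂ, w ≠ 0 → HasSum (fun k ↦ c k * w ^ k) 0) (n : ℤ) : c n = 0 := by
  have hc : Summable fun k ↦ ‖c k‖ := by simpa using (h 1 one_ne_zero).summable.norm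
  have : Fact ((0 : ℝ) < 1) := ⟨one_pos⟩
  -- Restrict to the unit circle and integrate termwise against the `-n`-th character.
  have key := MeasureTheory.hasSum_integral_of_summable_integral_norm
    (μ := haarAddCircle (T := 1))
    (F := fun (k : ℤ) (x : AddCircle (1 : ℝ)) ↦ fourier (-n) x • (c k * fourier k x)) ?_ ?_
  · have h1 : ∀ x : AddCircle (1 : ℝ),
        ∑' k : ℤ, (fourier (-n) x • (c k * fourier k x) : ℂ) = 0 := fun x ↦ by
      have h2 := (h (toCircle x) (Circle.coe_ne_zero _)).mul_left (fourier (-n) x)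
      rw [mul_zero] at h2
      refine (h2.congr_fun fun k ↦ ?_).tsum_eq
      simp [fourier_apply, toCircle_zsmul]
    have h2 : ∀ k : ℤ, ∫ x, (fourier (-n) x • (c k * fourier k x) : ℂ) ∂haarAddCircle (T := 1) =
        if k = n then c n else 0 := fun k ↦ by
      change fourierCoeff (fun x : AddCircle (1 : ℝ) ↦ c k * fourier k x) n = _
      rw [fourierCoeff.const_mul, fourierCoeff_fourier]
      by_cases hk : k = n
      · simp [hk]
      · simp [hk, Ne.symm hk]
    simp only [h1, h2, MeasureTheory.integral_zero] at key
    exact (hasSum_ite_eq n (c n)).unique key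
  · intro k
    exact Continuous.integrable_of_hasCompactSupport (by fun_prop)
      (HasCompactSupport.of_compactSpace _)
  · have h1 : ∀ (k : ℤ) (x : AddCircle (1 : ℝ)),
        ‖(fourier (-n) x • (c k * fourier k x) : ℂ)‖ = ‖c k‖ := fun k x ↦ by
      rw [norm_smul, norm_mul, fourier_apply, fourier_apply, Circle.norm_coe, Circle.norm_coe,
        one_mul, mul_one]
    simpa only [h1, MeasureTheory.integral_const, MeasureTheory.probReal_univ, one_smul] using hc

/-- A sum of monomials `f q w` satisfying `f(q, w q ^ M) = (w q ^ a)⁻¹ f(q, w)` is the product of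
its constant term in `w` and a theta function. -/
lemma IsPosLaurent₂.exists_eq_mul_theta {f : ℂ → ℂ → ℂ} (hf : IsPosLaurent₂ f) {a M : ℕ}
    (hM : M ≠ 0) (h : ∀ q w : ℂ, q ≠ 0 → ‖q‖ < 1 → w ≠ 0 →
      f q (w * q ^ M) = (w * q ^ a)⁻¹ * f q w) :
    ∃ g : ℂ → ℂ, IsPosLaurent g ∧ ∀ q w : ℂ, q ≠ 0 → ‖q‖ < 1 → w ≠ 0 →
      f q w = g q * _root_.theta (-w * q ^ a) (q ^ M) := by
  obtain ⟨ι, k, m, hm⟩ := hf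
  set A : ℂ → ℤ → ℂ := fun q n ↦ ∑' i : {i // k i = n}, q ^ m i with hA
  have hsum : ∀ q, q ≠ 0 → ‖q‖ < 1 → ∀ n, HasSum (fun i : {i // k i = n} ↦ q ^ m i) (A q n) := by
    intro q h0 h1 n
    have := (hm q 1 h0 h1 one_ne_zero).summable
    simp only [one_zpow, one_mul] at this
    exact (this.subtype _).hasSum
  have hexp : ∀ q w, q ≠ 0 → ‖q‖ < 1 → w ≠ 0 → HasSum (fun n ↦ A q n * w ^ n) (f q w) := by
    intro q w h0 h1 hw
    have h2 := (Equiv.sigmaFiberEquiv k).hasSum_iff.2 (hm q w h0 h1 hw)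
    refine h2.sigma fun n ↦ ?_
    have h3 := (hsum q h0 h1 n).mul_right (w ^ n)
    refine h3.congr_fun fun i ↦ ?_
    simp only [Function.comp, Equiv.sigmaFiberEquiv_apply, i.2]
    ring
  -- Compare coefficients of `w ^ n` in the functional equation; the recursion determines every `A q
  -- n` from `A q 0`.
  have hrec : ∀ q, q ≠ 0 → ‖q‖ < 1 → ∀ n, A q (n + 1) = q ^ a * (q ^ M) ^ n * A q n := by
    intro q h0 h1 n
    have := eq_zero_of_hasSum_zpow_zero (c := fun n ↦ A q n * (q ^ M) ^ n
      - (q ^ a)⁻¹ * A q (n + 1)) (fun w hw ↦ ?_) n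
    · field_simp at this
      linear_combination -this
    · have hwM := hexp q (w * q ^ M) h0 h1 (mul_ne_zero hw (pow_ne_zero _ h0))
      rw [h q w h0 h1 hw] at hwM
      have hw1 := (((Equiv.addRight (1 : ℤ)).hasSum_iff.2 (hexp q w h0 h1 hw)).mul_left
        (w * q ^ a)⁻¹)
      have hsub := hwM.sub hw1
      rw [sub_self] at hsub
      refine hsub.congr_fun fun n ↦ ?_
      simp only [Function.comp, Equiv.coe_addRight, mul_zpow, zpow_add_one₀ hw]
      field_simp
  have hclosed : ∀ q, q ≠ 0 → ‖q‖ < 1 → ∀ n, A q n = A q 0 * (q ^ a) ^ n * (q ^ M) ^ tri n := by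
    intro q h0 h1 n
    have hM0 : q ^ M ≠ 0 := pow_ne_zero _ h0
    have ha0 : q ^ a ≠ 0 := pow_ne_zero _ h0
    induction n using Int.induction_on with
    | zero => simp
    | succ n ih =>
      rw [hrec q h0 h1, ih, tri_add_one, zpow_add₀ hM0, zpow_add₀ ha0, zpow_one]
      ring
    | pred n ih =>
      have h2 := hrec q h0 h1 (-n - 1)
      have h3 := tri_add_one (-n - 1)
      rw [sub_add_cancel] at h2 h3
      rw [ih, h3, zpow_add₀ hM0] at h2
      rw [zpow_sub_one₀ ha0]
      have h4 : (q ^ M) ^ (-(n : ℤ) - 1) ≠ 0 := zpow_ne_zero _ hM0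
      refine mul_left_cancel₀ (mul_ne_zero ha0 h4) ?_
      rw [← h2]
      field_simp
  refine ⟨fun q ↦ A q 0, ⟨_, _, fun q h0 h1 ↦ hsum q h0 h1 0⟩, fun q w h0 h1 hw ↦ ?_⟩
  refine (hexp q w h0 h1 hw).unique ?_
  have h2 := hasSum_theta (z := -w * q ^ a) (q := q ^ M)
    (mul_ne_zero (neg_ne_zero.2 hw) (pow_ne_zero _ h0)) (pow_ne_zero _ h0)
    (by rw [norm_pow]; exact pow_lt_one₀ (norm_nonneg _) h1 hM)
  refine (h2.mul_left (A q 0)).congr_fun fun n ↦ ?_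
  rw [hclosed q h0 h1, neg_mul, neg_neg, mul_zpow]
  ring

/-! ### Two families of products with nonnegative expansions -/

lemma norm_pow_lt_one {q : ℂ} (hq : ‖q‖ < 1) {n : ℕ} (hn : n ≠ 0) : ‖q ^ n‖ < 1 := by
  rw [norm_pow]; exact pow_lt_one₀ (norm_nonneg _) hq hn

lemma prod_theta {z q : ℂ} (hz : z ≠ 0) (hq0 : q ≠ 0) (hq : ‖q‖ < 1) {k : ℕ} (hk : 0 < k) :
    (∏ i ∈ Finset.range k, theta (z * q ^ i) (q ^ k)) * qPoch q q =
      theta z q * qPoch (q ^ k) (q ^ k) ^ k := by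
  have h : ∏ i ∈ Finset.range k, qPoch (q ^ k / (z * q ^ i)) (q ^ k) = qPoch (q / z) q := by
    rw [qPoch_eq_prod_range (q / z) hq hk, ← Finset.prod_range_reflect]
    refine Finset.prod_congr rfl fun i hi ↦ ?_
    obtain ⟨d, rfl⟩ := Nat.exists_eq_add_of_lt (Finset.mem_range.1 hi)
    rw [show i + d + 1 - 1 - i = d by omega]
    congr 1
    field_simp
    ring
  unfold theta
  rw [Finset.prod_mul_distrib, Finset.prod_mul_distrib, ← qPoch_eq_prod_range z hq hk, h,
    Finset.prod_const, Finset.card_range]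
  ring

/-- The generating function of `k`-cores has nonnegative coefficients. -/
theorem isPosLaurent_core {k : ℕ} (hk : k ≠ 0) :
    IsPosLaurent fun q ↦ qPoch (q ^ k) (q ^ k) ^ k / qPoch q q := by
  have hprod : ∀ q w : ℂ, q ≠ 0 → ‖q‖ < 1 → w ≠ 0 →
      ∏ i ∈ Finset.range k, theta (-w * q ^ i) (q ^ k) =
        qPoch (q ^ k) (q ^ k) ^ k / qPoch q q * theta (-w) q := fun q w h0 h1 hw ↦ by
    have h2 := prod_theta (neg_ne_zero.2 hw) h0 h1 (Nat.pos_of_ne_zero hk)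
    have h3 := qPoch_ne_zero_of_norm_lt_one h1 h1
    rw [div_mul_eq_mul_div, eq_div_iff h3, h2]
    ring
  -- The product is a multiple, free of `w`, of `theta (-w) q`, whence the quasi-periodicity with `a
  -- = 0`, `M = 1`.
  obtain ⟨g, hg, hfg⟩ := IsPosLaurent₂.exists_eq_mul_theta (a := 0) (M := 1)
    (f := fun q w ↦ ∏ i ∈ Finset.range k, theta (-w * q ^ i) (q ^ k))
    (IsPosLaurent₂.prod _ fun i _ ↦ IsPosLaurent₂.theta i k hk) one_ne_zero
    fun q w h0 h1 hw ↦ by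
      rw [hprod q w h0 h1 hw, hprod q _ h0 h1 (mul_ne_zero hw (pow_ne_zero _ h0)), pow_one,
        ← neg_mul, theta_mul_base h1 h0 (neg_ne_zero.2 hw), pow_zero, mul_one, inv_neg, neg_neg]
      ring
  refine hg.congr fun q h0 h1 ↦ ?_
  have h2 := hfg q 1 h0 h1 one_ne_zero
  rw [hprod q 1 h0 h1 one_ne_zero, pow_zero, mul_one, pow_one] at h2
  have h3 : theta (-1) q ≠ 0 := by
    refine mul_ne_zero (mul_ne_zero (qPoch_ne_zero h1 fun n hn ↦ ?_)
      (qPoch_ne_zero_of_norm_lt_one h1 (by simpa using h1)))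
      (qPoch_ne_zero_of_norm_lt_one h1 h1)
    rcases Nat.eq_zero_or_pos n with rfl | hpos
    · norm_num at hn
    · have h4 := norm_pow_lt_one h1 hpos.ne'
      have h5 := congrArg norm hn
      simp only [neg_mul, one_mul, norm_neg, norm_one] at h5
      linarith
  exact (mul_right_cancel₀ h3 h2).symm

/-- Shifting `i` moves the marked position `j` to `j + 1` cyclically; `hxy` gives the term that
wraps around from `j = r` to `0` the same multiplier `x / c`. -/
lemma sum_prod_ite_shift {r : ℕ} {u v : ℕ → ℂ} {c x y : ℂ} (hc : c ≠ 0)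
    (hu : u (r + 1) = x * u 0) (hv : v (r + 1) = y * v 0) (hxy : y * c ^ (r + 1) = x) :
    ∑ j ∈ Finset.range (r + 1), c ^ j *
        ∏ i ∈ Finset.range (r + 1), (if i = j then v (i + 1) else u (i + 1)) =
      x / c * ∑ j ∈ Finset.range (r + 1), c ^ j *
        ∏ i ∈ Finset.range (r + 1), (if i = j then v i else u i) := by
  rw [Finset.sum_range_succ, Finset.sum_range_succ' (fun j ↦ c ^ j * _), mul_add, Finset.mul_sum]
  congr 1
  · refine Finset.sum_congr rfl fun j hj ↦ ?_
    rw [Finset.prod_range_succ, Finset.prod_range_succ',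
      if_neg (Finset.mem_range.1 hj).ne', if_neg (Nat.succ_ne_zero j).symm, hu]
    simp only [Nat.add_right_cancel_iff]
    field_simp
    ring
  · rw [Finset.prod_range_succ, Finset.prod_range_succ', if_pos rfl, if_pos rfl, hv]
    have h1 : ∏ i ∈ Finset.range r, (if i = r then v (i + 1) else u (i + 1)) =
        ∏ i ∈ Finset.range r, u (i + 1) :=
      Finset.prod_congr rfl fun i hi ↦ if_neg (Finset.mem_range.1 hi).ne
    simp only [h1, Nat.succ_ne_zero, if_false, ← hxy]
    field_simp
    ring

/-- Both `i` and `r + 1 - i` run over the nonzero residues modulo `r + 1`, so each of the first two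
theta factors contributes `(q;q)` without its zero residue class. -/
lemma prod_theta_pow {q : ℂ} (hq0 : q ≠ 0) (hq : ‖q‖ < 1) (r : ℕ) :
    (∏ i ∈ Finset.range r, theta (q ^ (i + 1)) (q ^ (r + 1))) * qPoch (q ^ (r + 1)) (q ^ (r + 1)) ^ 2
      = qPoch q q ^ 2 * qPoch (q ^ (r + 1)) (q ^ (r + 1)) ^ r := by
  set A := ∏ i ∈ Finset.range r, qPoch (q ^ (i + 1)) (q ^ (r + 1)) with hA
  have h1 : ∏ i ∈ Finset.range r, qPoch (q ^ (r + 1) / q ^ (i + 1)) (q ^ (r + 1)) = A := by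
    rw [hA, ← Finset.prod_range_reflect]
    refine Finset.prod_congr rfl fun i hi ↦ ?_
    obtain ⟨d, rfl⟩ := Nat.exists_eq_add_of_lt (Finset.mem_range.1 hi)
    rw [show i + d + 1 - 1 - i = d by omega]
    congr 1
    field_simp
    ring
  have h2 : qPoch q q = A * qPoch (q ^ (r + 1)) (q ^ (r + 1)) := by
    rw [qPoch_eq_prod_range q hq r.succ_pos, Finset.prod_range_succ, hA]
    simp only [pow_succ']
  simp only [theta, Finset.prod_mul_distrib, h1, Finset.prod_const, Finset.card_range]
  rw [h2, ← hA]
  ring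

/-- For `z = q ^ a` and `Q = q ^ M` with `0 < a < M`, the quotient of
`(z ^ p; Q ^ p)_∞ (Q ^ p / z ^ p; Q ^ p)_∞` by `(z; Q)_∞ (Q / z; Q)_∞` has nonnegative coefficients
after multiplication by `(Q ^ p; Q ^ p)_∞ ^ (2 (p - 1))`. Here `p = r + 1`. -/
theorem isPosLaurent_theta_quotient {a b : ℕ} (ha : a ≠ 0) (hb : b ≠ 0) (r : ℕ) :
    IsPosLaurent fun q ↦
      qPoch (q ^ ((a + b) * (r + 1))) (q ^ ((a + b) * (r + 1))) ^ (2 * r) *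
        (qPoch (q ^ (a * (r + 1))) (q ^ ((a + b) * (r + 1))) *
          qPoch (q ^ (b * (r + 1))) (q ^ ((a + b) * (r + 1)))) /
        (qPoch (q ^ a) (q ^ (a + b)) * qPoch (q ^ b) (q ^ (a + b))) := by
  have hM : a + b ≠ 0 := by omega
  have hMp : (a + b) * (r + 1) ≠ 0 := by positivity
  -- In the `j`-th summand one factor has its argument multiplied by `q ^ (a * (r + 1))`. Replacing
  -- `w` by `w * q ^ (a + b)` rotates the factors, and the weight `(q ^ a) ^ j` absorbs the extra
  -- multiplier on wrapping.
  obtain ⟨g, hg, hfg⟩ := IsPosLaurent₂.exists_eq_mul_theta (a := a) (M := a + b)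
    (f := fun q w ↦ ∑ j ∈ Finset.range (r + 1), (q ^ a) ^ j * ∏ i ∈ Finset.range (r + 1),
      theta (-w * q ^ ((if i = j then a * (r + 1) else 0) + (a + b) * i))
        (q ^ ((a + b) * (r + 1))))
    (IsPosLaurent₂.sum _ fun j _ ↦ .mul (.of_isPosLaurent (((IsPosLaurent.zpow a).pow j).congr
      fun q _ _ ↦ by rw [zpow_natCast])) <| .prod _ fun i _ ↦ .theta _ _ hMp) hM
    fun q w h0 h1 hw ↦ by
      have hper : ∀ c : ℕ, theta (-w * q ^ (c + (a + b) * (r + 1))) (q ^ ((a + b) * (r + 1))) =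
          w⁻¹ * (q ^ c)⁻¹ * theta (-w * q ^ c) (q ^ ((a + b) * (r + 1))) := fun c ↦ by
        rw [pow_add, ← mul_assoc, theta_mul_base (norm_pow_lt_one h1 hMp) (pow_ne_zero _ h0)
          (mul_ne_zero (neg_ne_zero.2 hw) (pow_ne_zero _ h0))]
        congr 1
        field_simp
      have key := sum_prod_ite_shift (r := r) (c := q ^ a) (x := w⁻¹)
        (y := w⁻¹ * (q ^ (a * (r + 1)))⁻¹)
        (u := fun i ↦ theta (-w * q ^ (0 + (a + b) * i)) (q ^ ((a + b) * (r + 1))))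
        (v := fun i ↦ theta (-w * q ^ (a * (r + 1) + (a + b) * i)) (q ^ ((a + b) * (r + 1))))
        (pow_ne_zero _ h0) (by simpa using hper 0) (by simpa using hper (a * (r + 1))) (by
          rw [← pow_mul]
          have := pow_ne_zero (a * (r + 1)) h0
          field_simp)
      have hshift : ∀ c i : ℕ, -(w * q ^ (a + b)) * q ^ (c + (a + b) * i) =
          -w * q ^ (c + (a + b) * (i + 1)) := fun c i ↦ by ring
      simp only [hshift]
      convert key using 1
      · refine Finset.sum_congr rfl fun j _ ↦ ?_
        congr 1
        refine Finset.prod_congr rfl fun i _ ↦ ?_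
        split_ifs <;> rfl
      · congr 1
        · rw [mul_inv]; rfl
        · refine Finset.sum_congr rfl fun j _ ↦ ?_
          congr 1
          refine Finset.prod_congr rfl fun i _ ↦ ?_
          split_ifs <;> rfl
  -- With `Q = q ^ (a + b)` and `p = r + 1`, `g` carries `(Q;Q) (Q^p;Q^p)^(r-1)`; the core series in
  -- `Q` turns this into `(Q^p;Q^p)^(2r)`.
  have hcore := (isPosLaurent_core (k := r + 1) (by omega)).comp_pow hM
  refine (hg.mul hcore).congr fun q h0 h1 ↦ ?_
  have h2 := hfg q (-1) h0 h1 (by norm_num)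
  simp only [neg_neg, one_mul] at h2
  have hQ := norm_pow_lt_one h1 hM
  have hQp := norm_pow_lt_one h1 hMp
  -- At `w = -1` each summand with `j ≠ 0` contains `theta 1 = 0` at `i = 0`.
  rw [Finset.sum_eq_single_of_mem 0 (by simp) fun j _ hj ↦ by
    rw [Finset.prod_eq_zero (Finset.mem_range.2 r.succ_pos), mul_zero]
    simpa [hj.symm] using theta_one hQp, Finset.prod_range_succ'] at h2
  simp only [pow_zero, one_mul, if_true, mul_zero, add_zero, Nat.succ_ne_zero, if_false,
    zero_add] at h2
  have h3 := prod_theta_pow (pow_ne_zero (a + b) h0) hQ r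
  simp only [← pow_mul] at h3 ⊢
  have e1 : q ^ ((a + b) * (r + 1)) / q ^ (a * (r + 1)) = q ^ (b * (r + 1)) := by
    rw [add_mul, pow_add]; field_simp
  have e2 : q ^ (a + b) / q ^ a = q ^ b := by
    rw [pow_add]; field_simp
  simp only [theta, e1, e2] at h2
  simp only [theta] at h3
  have n1 := qPoch_ne_zero_of_norm_lt_one hQ hQ
  have n2 := qPoch_ne_zero_of_norm_lt_one hQp hQp
  have n3 := qPoch_ne_zero_of_norm_lt_one hQ (norm_pow_lt_one h1 ha)
  have n4 := qPoch_ne_zero_of_norm_lt_one hQ (norm_pow_lt_one h1 hb)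
  generalize qPoch (q ^ ((a + b) * (r + 1))) (q ^ ((a + b) * (r + 1))) = E at *
  rw [mul_div_assoc', div_eq_div_iff n1 (mul_ne_zero n3 n4)]
  refine mul_left_cancel₀ n1 ?_
  linear_combination -E ^ (r + 1) * h2 + (qPoch (q ^ (a * (r + 1))) (q ^ ((a + b) * (r + 1))) *
    qPoch (q ^ (b * (r + 1))) (q ^ ((a + b) * (r + 1)))) * E ^ r * h3

/-! ### Products over divisors weighted by the Möbius function -/

open ArithmeticFunction (moebius)

section Moebius

variable {G : Type*} [DivisionCommMonoid G]

lemma sum_moebius_divisors {n : ℕ} : ∑ d ∈ n.divisors, moebius d = if n = 1 then 1 else 0 := by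
  rw [← ArithmeticFunction.coe_mul_zeta_apply, ArithmeticFunction.moebius_mul_coe_zeta,
    ArithmeticFunction.one_apply]

/-- When `p ∣ M`, every squarefree divisor of `p * M` already divides `M`. The general `G` serves
both `q`-products and, through `Multiplicative ℤ`, sums. -/
lemma prod_divisors_moebius_of_dvd (F : ℕ → G) {p M : ℕ} (hp : p.Prime) (hM : M ≠ 0)
    (hpM : p ∣ M) :
    ∏ d ∈ (p * M).divisors, F d ^ moebius d = ∏ d ∈ M.divisors, F d ^ moebius d := by
  symm
  refine Finset.prod_subset (Nat.divisors_subset_of_dvd (mul_ne_zero hp.ne_zero hM)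
    (dvd_mul_left _ _)) fun d hd hdM ↦ ?_
  rw [ArithmeticFunction.moebius_eq_zero_of_not_squarefree, zpow_zero]
  intro hsq
  refine hdM (Nat.mem_divisors.2 ⟨?_, hM⟩)
  have hd' := Nat.dvd_of_mem_divisors hd
  by_cases h : p ∣ d
  · obtain ⟨e, rfl⟩ := h
    have he : e ∣ M := Nat.dvd_of_mul_dvd_mul_left hp.pos hd'
    exact (Nat.coprime_of_squarefree_mul hsq).mul_dvd_of_dvd_of_dvd hpM he
  · exact ((Nat.Prime.coprime_iff_not_dvd hp).2 h).symm.dvd_of_dvd_mul_left hd'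

lemma prod_divisors_moebius_of_not_dvd (F : ℕ → G) {p M : ℕ} (hp : p.Prime) (hpM : ¬ p ∣ M) :
    ∏ d ∈ (p * M).divisors, F d ^ moebius d =
      (∏ d ∈ M.divisors, F d ^ moebius d) / ∏ d ∈ M.divisors, F (p * d) ^ moebius d := by
  classical
  have hM : M ≠ 0 := by rintro rfl; simp at hpM
  have h1 : (p * M).divisors = M.divisors ∪ M.divisors.image (p * ·) := by
    ext d
    simp only [Finset.mem_union, Finset.mem_image, Nat.mem_divisors]
    constructor
    · rintro ⟨hd, -⟩
      by_cases h : p ∣ d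
      · obtain ⟨e, rfl⟩ := h
        exact .inr ⟨e, ⟨Nat.dvd_of_mul_dvd_mul_left hp.pos hd, hM⟩, rfl⟩
      · exact .inl ⟨((Nat.Prime.coprime_iff_not_dvd hp).2 h).symm.dvd_of_dvd_mul_left hd, hM⟩
    · rintro (⟨hd, -⟩ | ⟨e, ⟨he, -⟩, rfl⟩)
      · exact ⟨hd.mul_left _, mul_ne_zero hp.ne_zero hM⟩
      · exact ⟨mul_dvd_mul_left _ he, mul_ne_zero hp.ne_zero hM⟩
  have h2 : Disjoint M.divisors (M.divisors.image (p * ·)) := by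
    refine Finset.disjoint_left.2 fun d hd hd' ↦ hpM ?_
    obtain ⟨e, -, rfl⟩ := Finset.mem_image.1 hd'
    exact (dvd_mul_right p e).trans (Nat.dvd_of_mem_divisors hd)
  rw [h1, Finset.prod_union h2, Finset.prod_image fun x _ y _ h ↦ Nat.eq_of_mul_eq_mul_left hp.pos h,
    div_eq_mul_inv, ← Finset.prod_inv_distrib]
  congr 1
  refine Finset.prod_congr rfl fun d hd ↦ ?_
  have hcop : p.Coprime d := (Nat.Prime.coprime_iff_not_dvd hp).2 fun h ↦
    hpM (h.trans (Nat.dvd_of_mem_divisors hd))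
  rw [ArithmeticFunction.isMultiplicative_moebius.map_mul_of_coprime hcop,
    ArithmeticFunction.moebius_apply_prime hp, neg_one_mul, zpow_neg]

/-- Pairing the residues coprime to an odd number `M` as `a ↔ M - a`. -/
lemma prod_coprime_eq_prod_half {M : ℕ} (hM : Odd M) (hM1 : M ≠ 1) (Y : ℕ → G) :
    ∏ a ∈ Finset.Ico 1 (1 + M) with M.Coprime a, Y a =
      ∏ a ∈ Finset.Ico 1 (1 + M) with M.Coprime a ∧ 2 * a < M, (Y a * Y (M - a)) := by
  -- `M ≠ 1` excludes `a = M`, whose partner would be `0`; oddness excludes a fixed point of the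
  -- pairing.
  have hne : ∀ a, M.Coprime a → a ≠ M := by
    rintro a h rfl
    exact hM1 ((Nat.coprime_self _).1 h)
  obtain ⟨m, rfl⟩ := hM
  rw [← Finset.prod_filter_mul_prod_filter_not _ (fun a ↦ 2 * a < 2 * m + 1),
    Finset.prod_mul_distrib, Finset.filter_filter, Finset.filter_filter]
  congr 1
  refine Finset.prod_bij' (fun a _ ↦ 2 * m + 1 - a) (fun a _ ↦ 2 * m + 1 - a) ?_ ?_ ?_ ?_ ?_
  · intro a ha
    simp only [Finset.mem_filter, Finset.mem_Ico] at ha ⊢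
    have := hne a ha.2.1
    exact ⟨by omega, (Nat.coprime_self_sub_right (by omega)).2 ha.2.1, by omega⟩
  · intro a ha
    simp only [Finset.mem_filter, Finset.mem_Ico] at ha ⊢
    exact ⟨by omega, (Nat.coprime_self_sub_right (by omega)).2 ha.2.1, by omega⟩
  · intro a ha
    simp only [Finset.mem_filter, Finset.mem_Ico] at ha ⊢
    omega
  · intro a ha
    simp only [Finset.mem_filter, Finset.mem_Ico] at ha ⊢
    omega
  · intro a ha
    simp only [Finset.mem_filter, Finset.mem_Ico] at ha ⊢
    congr 1
    omega

lemma totient_eq_two_mul_card_half {M : ℕ} (hM : Odd M) (hM1 : M ≠ 1) :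
    M.totient = 2 * Finset.card {a ∈ Finset.Ico 1 (1 + M) | M.Coprime a ∧ 2 * a < M} := by
  have h := prod_coprime_eq_prod_half hM hM1 fun _ ↦ Multiplicative.ofAdd (1 : ℤ)
  simp only [Finset.prod_const, ← ofAdd_nsmul, Nat.filter_coprime_Ico_eq_totient,
    ← ofAdd_add] at h
  have h2 := Multiplicative.ofAdd.injective h
  simp at h2
  omega

end Moebius

lemma prod_zpow_eq_zpow_sum {α : Type*} {x : ℂ} (hx : x ≠ 0) (s : Finset α) (f : α → ℤ) :
    ∏ i ∈ s, x ^ f i = x ^ ∑ i ∈ s, f i := by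
  classical
  induction s using Finset.induction_on with
  | empty => simp
  | insert a s ha ih => rw [Finset.prod_insert ha, Finset.sum_insert ha, zpow_add₀ hx, ih]

/-! ### Möbius products and positivity of the eta series -/

/-- `∏_{d ∣ N} (q ^ d; q ^ d)_∞ ^ μ(d)`. -/
noncomputable def moebiusProd (N : ℕ) (q : ℂ) : ℂ :=
  ∏ d ∈ N.divisors, qPoch (q ^ d) (q ^ d) ^ moebius d

lemma qPoch_pow_self_ne_zero {q : ℂ} (hq : ‖q‖ < 1) {d : ℕ} (hd : d ≠ 0) :
    qPoch (q ^ d) (q ^ d) ≠ 0 :=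
  qPoch_ne_zero_of_norm_lt_one (norm_pow_lt_one hq hd) (norm_pow_lt_one hq hd)

lemma qPoch_pow_self_eq_prod {M d : ℕ} (hM : M ≠ 0) (hd : d ∣ M) {q : ℂ} (hq : ‖q‖ < 1) :
    qPoch (q ^ d) (q ^ d) = ∏ a ∈ Finset.Ico 1 (1 + M), if d ∣ a then qPoch (q ^ a) (q ^ M) else 1 := by
  obtain ⟨k, rfl⟩ := hd
  obtain ⟨hd0, hk0⟩ := mul_ne_zero_iff.1 hM
  rw [qPoch_eq_prod_range (q ^ d) (norm_pow_lt_one hq hd0) (Nat.pos_of_ne_zero hk0),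
    ← Finset.prod_filter]
  refine Finset.prod_bij (fun i _ ↦ d * (i + 1)) ?_ ?_ ?_ ?_
  · intro i hi
    have h1 : d * (i + 1) ≤ d * k := Nat.mul_le_mul_left _ (Finset.mem_range.1 hi)
    have h2 : 0 < d * (i + 1) := by positivity
    simp only [Finset.mem_filter, Finset.mem_Ico]
    exact ⟨by omega, dvd_mul_right _ _⟩
  · intro i _ j _ h
    simpa using Nat.eq_of_mul_eq_mul_left (Nat.pos_of_ne_zero hd0) h
  · intro a ha
    simp only [Finset.mem_filter, Finset.mem_Ico] at ha
    obtain ⟨h1, c, rfl⟩ := ha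
    have hc : c ≠ 0 := by rintro rfl; simp at h1
    obtain ⟨i, rfl⟩ := Nat.exists_eq_succ_of_ne_zero hc
    refine ⟨i, Finset.mem_range.2 ?_, rfl⟩
    have : d * (i + 1) ≤ d * k := by have := h1.2; simp only [Nat.succ_eq_add_one] at this; omega
    exact Nat.le_of_mul_le_mul_left this (Nat.pos_of_ne_zero hd0)
  · intro i _
    rw [← pow_mul, ← pow_mul, ← pow_add]
    ring_nf

/-- After interchanging the products, `(q^a;q^M)` has exponent `∑ μ(d)` over `d ∣ gcd(M, a)`, which
is 1 or 0 according as `a` is prime to `M` or not. -/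
lemma moebiusProd_eq_prod_coprime {M : ℕ} (hM : M ≠ 0) {q : ℂ} (hq : ‖q‖ < 1) :
    moebiusProd M q = ∏ a ∈ Finset.Ico 1 (1 + M) with M.Coprime a, qPoch (q ^ a) (q ^ M) := by
  have h1 : ∀ a ∈ Finset.Ico 1 (1 + M), qPoch (q ^ a) (q ^ M) ≠ 0 := fun a ha ↦
    qPoch_ne_zero_of_norm_lt_one (norm_pow_lt_one hq hM)
      (norm_pow_lt_one hq (by simp at ha; omega))
  unfold moebiusProd
  rw [Finset.prod_congr rfl fun d hd ↦ by
    rw [qPoch_pow_self_eq_prod hM (Nat.dvd_of_mem_divisors hd) hq, ← Finset.prod_zpow],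
    Finset.prod_comm, Finset.prod_filter]
  refine Finset.prod_congr rfl fun a ha ↦ ?_
  have h2 : ∀ d ∈ M.divisors, (if d ∣ a then qPoch (q ^ a) (q ^ M) else 1) ^ moebius d =
      qPoch (q ^ a) (q ^ M) ^ (if d ∣ a then moebius d else 0) := fun d _ ↦ by
    split_ifs <;> simp
  have h3 : {d ∈ M.divisors | d ∣ a} = (M.gcd a).divisors := by
    ext d
    simp only [Finset.mem_filter, Nat.mem_divisors, Nat.dvd_gcd_iff]
    have : M.gcd a ≠ 0 := (Nat.gcd_pos_of_pos_left _ (Nat.pos_of_ne_zero hM)).ne'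
    tauto
  rw [Finset.prod_congr rfl h2, prod_zpow_eq_zpow_sum (h1 a ha), ← Finset.sum_filter, h3, sum_moebius_divisors]
  simp only [Nat.Coprime]
  split_ifs <;> simp

/-- The eta product, without its power of `q`. -/
noncomputable def etaSeries (N : ℕ) (q : ℂ) : ℂ :=
  qPoch (q ^ N) (q ^ N) ^ N.totient / moebiusProd N q

lemma isPosLaurent_etaSeries_of_odd {p M : ℕ} (hp : p.Prime) (hpM : ¬ p ∣ M) (hM : Odd M) :
    IsPosLaurent (etaSeries (p * M)) := by
  have hdiv : ∀ q : ℂ, moebiusProd (p * M) q = moebiusProd M q / moebiusProd M (q ^ p) := fun q ↦ by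
    unfold moebiusProd
    rw [prod_divisors_moebius_of_not_dvd (fun d ↦ qPoch (q ^ d) (q ^ d)) hp hpM]
    simp only [pow_mul]
  obtain ⟨r, rfl⟩ := Nat.exists_eq_succ_of_ne_zero hp.ne_zero
  rw [Nat.succ_eq_add_one] at *
  have hM0 : M ≠ 0 := by rintro rfl; simp at hpM
  by_cases hM1 : M = 1
  · subst hM1
    refine (isPosLaurent_core (k := r + 1) (by omega)).congr fun q h0 h1 ↦ ?_
    have n1 := qPoch_ne_zero_of_norm_lt_one h1 h1
    have n2 := qPoch_pow_self_ne_zero h1 (Nat.succ_ne_zero r)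
    rw [etaSeries, hdiv, mul_one, Nat.totient_prime hp]
    simp only [moebiusProd, Nat.divisors_one, Finset.prod_singleton, pow_one,
      ArithmeticFunction.moebius_apply_one, zpow_one, Nat.add_sub_cancel]
    field_simp
    ring
  -- Each pair `{a, M - a}` thus receives exactly the `2r` copies required by
  -- `isPosLaurent_theta_quotient`.
  · have htot : ((r + 1) * M).totient =
        2 * r * Finset.card {a ∈ Finset.Ico 1 (1 + M) | M.Coprime a ∧ 2 * a < M} := by
      rw [Nat.totient_mul ((Nat.Prime.coprime_iff_not_dvd hp).2 hpM), Nat.totient_prime hp,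
        totient_eq_two_mul_card_half hM hM1, Nat.add_sub_cancel]
      ring
    have key := IsPosLaurent.prod {a ∈ Finset.Ico 1 (1 + M) | M.Coprime a ∧ 2 * a < M}
      (f := fun a q ↦ qPoch (q ^ (M * (r + 1))) (q ^ (M * (r + 1))) ^ (2 * r) *
        (qPoch (q ^ (a * (r + 1))) (q ^ (M * (r + 1))) *
          qPoch (q ^ ((M - a) * (r + 1))) (q ^ (M * (r + 1)))) /
        (qPoch (q ^ a) (q ^ M) * qPoch (q ^ (M - a)) (q ^ M))) fun a ha ↦ by
      simp only [Finset.mem_filter, Finset.mem_Ico] at ha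
      have h := isPosLaurent_theta_quotient (a := a) (b := M - a) (by omega) (by omega) r
      rwa [show a + (M - a) = M by omega] at h
    refine key.congr fun q h0 h1 ↦ ?_
    have hp0 := hp.ne_zero
    rw [etaSeries, hdiv, htot, moebiusProd_eq_prod_coprime hM0 h1,
      moebiusProd_eq_prod_coprime hM0 (norm_pow_lt_one h1 hp0),
      prod_coprime_eq_prod_half hM hM1, prod_coprime_eq_prod_half hM hM1,
      Finset.prod_div_distrib, Finset.prod_mul_distrib, Finset.prod_const, ← pow_mul,
      div_div_eq_mul_div]
    simp only [← pow_mul, mul_comm]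

lemma isPosLaurent_etaSeries {N : ℕ} (hN : N ≠ 0) : IsPosLaurent (etaSeries N) := by
  induction N using Nat.strong_induction_on with
  | _ N ih =>
  by_cases hN1 : N = 1
  · subst hN1
    refine IsPosLaurent.one.congr fun q _ h1 ↦ ?_
    have n1 := qPoch_ne_zero_of_norm_lt_one h1 h1
    simp [etaSeries, moebiusProd, n1]
  have hp := Nat.minFac_prime hN1
  obtain ⟨M, hM⟩ := N.minFac_dvd
  have hM0 : M ≠ 0 := by rintro rfl; exact hN hM
  by_cases hpM : N.minFac ∣ M
  · have hlt : M < N := by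
      conv_rhs => rw [hM]
      exact lt_mul_left (Nat.pos_of_ne_zero hM0) hp.one_lt
    refine ((ih M hlt hM0).mul (((isPosLaurent_core hp.ne_zero).comp_pow hM0).pow M.totient)).congr
      fun q h0 h1 ↦ ?_
    have e : etaSeries N q = qPoch (q ^ N) (q ^ N) ^ (N.minFac * M.totient) / moebiusProd M q := by
      have h2 : moebiusProd N q = moebiusProd M q := by
        unfold moebiusProd
        conv_lhs => rw [hM]
        exact prod_divisors_moebius_of_dvd _ hp hM0 hpM
      have h3 : N.totient = N.minFac * M.totient := by
        conv_lhs => rw [hM]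
        exact Nat.totient_mul_of_prime_of_dvd hp hpM
      rw [etaSeries, h2, h3]
    have n1 := qPoch_pow_self_ne_zero h1 hM0
    rw [e, etaSeries, div_pow, ← pow_mul q, ← pow_mul, mul_comm M, ← hM]
    field_simp
  -- This is why `p` is the least prime factor: an even `M` would force `p = 2 ∣ M`.
  · have hodd : Odd M := by
      rw [← Nat.not_even_iff_odd]
      intro hev
      have h2 : 2 ∣ N := by rw [hM]; exact hev.two_dvd.mul_left _
      rw [Nat.minFac_eq_two_iff N |>.2 h2] at hpM
      exact hpM hev.two_dvd
    rw [hM]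
    exact isPosLaurent_etaSeries_of_odd hp hpM hodd

/-! ### Power series expansions -/

/-- At small real `x > 0` all terms are positive, so a negative exponent would make the sum at least
`x⁻¹`, beyond any bound. -/
lemma IsPosLaurent.exponent_nonneg {f : ℂ → ℂ} {ι : Type} {m : ι → ℤ}
    (hm : ∀ q : ℂ, q ≠ 0 → ‖q‖ < 1 → HasSum (fun i ↦ q ^ m i) (f q)) {C : ℝ}
    (hC : ∀ᶠ q in 𝓝[≠] 0, ‖f q‖ ≤ C) (i : ι) : 0 ≤ m i := by
  by_contra! hi
  rw [eventually_nhdsWithin_iff, Metric.eventually_nhds_iff] at hC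
  obtain ⟨ε, hε, hC⟩ := hC
  obtain ⟨x, hx0, hx⟩ := exists_between (lt_min hε (lt_min one_pos (inv_pos.2
    (show 0 < |C| + 1 by positivity))))
  simp only [lt_min_iff] at hx
  obtain ⟨hxε, hx1, hxC⟩ := hx
  have h1 : ‖(x : ℂ)‖ = x := by simp [abs_of_pos hx0]
  have hx0' : (x : ℂ) ≠ 0 := by exact_mod_cast hx0.ne'
  have h2 := Complex.hasSum_re (hm x hx0' (by rwa [h1]))
  have h3 : ∀ j, ((x : ℂ) ^ m j).re = x ^ m j := fun j ↦ by
    rw [← Complex.ofReal_zpow, Complex.ofReal_re]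
  simp only [h3] at h2
  have h4 := le_hasSum h2 i fun j _ ↦ (zpow_pos hx0 _).le
  have h5 : (f x).re ≤ C := (Complex.re_le_norm _).trans
    (hC (by simpa [abs_of_pos hx0] using hxε) hx0')
  have h6 : x⁻¹ ≤ x ^ m i := by
    rw [← zpow_neg_one]
    exact zpow_le_zpow_right_of_le_one₀ hx0 hx1.le (by omega)
  have h7 : |C| + 1 < x⁻¹ := (lt_inv_comm₀ hx0 (by positivity)).1 hxC
  have := le_abs_self C
  linarith

/-- A sum of Laurent monomials that is bounded near the origin is given by a power series with
nonnegative coefficients. -/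
lemma IsPosLaurent.exists_hasSum_pow {f : ℂ → ℂ} (hf : IsPosLaurent f) {C : ℝ}
    (hC : ∀ᶠ q in 𝓝[≠] 0, ‖f q‖ ≤ C) :
    ∃ c : ℕ → ℝ, (∀ n, 0 ≤ c n) ∧
      ∀ q : ℂ, q ≠ 0 → ‖q‖ < 1 → HasSum (fun n ↦ (c n : ℂ) * q ^ n) (f q) := by
  obtain ⟨ι, m, hm⟩ := hf
  lift m to ι → ℕ using exponent_nonneg hm hC
  refine ⟨fun n ↦ ∑' _ : {i // m i = n}, 1, fun n ↦ tsum_nonneg fun _ ↦ zero_le_one,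
    fun q h0 h1 ↦ ?_⟩
  have h2 := (Equiv.sigmaFiberEquiv m).hasSum_iff.2 (hm q h0 h1)
  refine h2.sigma fun n ↦ ?_
  -- Dividing by `q ^ n` shows that the constant series 1 over the fibre converges, so the `tsum`
  -- defining `c n` is a true count and not the default 0.
  have h3 := ((hm q h0 h1).summable.subtype {i | m i = n}).hasSum.mul_right (q ^ n)⁻¹
  have h4 : Summable fun _ : {i // m i = n} ↦ (1 : ℂ) := h3.summable.congr fun i ↦ by
    have h5 : m i.1 = n := i.2
    simp [h5, h0]
  have h6 := h4.hasSum.mul_right (q ^ n)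
  rw [Complex.ofReal_tsum]
  simp only [Complex.ofReal_one]
  refine h6.congr_fun fun i ↦ ?_
  simp [i.2]

lemma tendsto_qPoch_self : Tendsto (fun q ↦ qPoch q q) (𝓝 0) (𝓝 1) := by
  have h := (ModularForm.differentiableOn_tprod_one_sub_pow.differentiableAt
    (Metric.ball_mem_nhds (0 : ℂ) one_pos)).continuousAt.tendsto
  simpa [qPoch, pow_succ'] using h

lemma tendsto_etaSeries {N : ℕ} (hN : N ≠ 0) : Tendsto (etaSeries N) (𝓝 0) (𝓝 1) := by
  have h1 : ∀ d : ℕ, d ≠ 0 → Tendsto (fun q : ℂ ↦ qPoch (q ^ d) (q ^ d)) (𝓝 0) (𝓝 1) :=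
    fun d hd ↦ tendsto_qPoch_self.comp (by simpa [hd] using (continuous_pow d).tendsto (0 : ℂ))
  have h2 : Tendsto (moebiusProd N) (𝓝 0) (𝓝 1) := by
    have := tendsto_finsetProd N.divisors fun d hd ↦
      (h1 d (Nat.pos_of_mem_divisors hd).ne').zpow₀ (moebius d) (.inl one_ne_zero)
    simp only [one_zpow, Finset.prod_const_one] at this
    exact this
  have h3 := ((h1 N hN).pow N.totient).div h2 one_ne_zero
  rw [one_pow, div_one] at h3
  exact h3

/-- The sum is `∏ (1 - p)` over primes `p ∣ N`: a new prime multiplies both sides by `p - 1`, a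
repeated one only enlarges the totient. It keeps the leading exponent of the eta product
nonnegative. -/
lemma abs_sum_moebius_mul_le (N : ℕ) (hN : N ≠ 0) :
    |∑ d ∈ N.divisors, moebius d * (d : ℤ)| ≤ N.totient := by
  have key : ∀ n : ℕ, ∏ d ∈ n.divisors, Multiplicative.ofAdd (d : ℤ) ^ moebius d =
      Multiplicative.ofAdd (∑ d ∈ n.divisors, moebius d * (d : ℤ)) := fun n ↦ by
    rw [ofAdd_sum]
    simp [← ofAdd_zsmul]
  induction N using induction_on_primes with
  | zero => exact absurd rfl hN
  | one => simp
  | prime_mul p M hp ih =>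
    have hM : M ≠ 0 := (mul_ne_zero_iff.1 hN).2
    have ih := ih hM
    by_cases hpM : p ∣ M
    · have h := prod_divisors_moebius_of_dvd (fun d ↦ Multiplicative.ofAdd (d : ℤ)) hp hM hpM
      rw [key, key] at h
      rw [Multiplicative.ofAdd.injective h, Nat.totient_mul_of_prime_of_dvd hp hpM]
      exact ih.trans (by exact_mod_cast Nat.le_mul_of_pos_left _ hp.pos)
    · have h := prod_divisors_moebius_of_not_dvd (fun d ↦ Multiplicative.ofAdd (d : ℤ)) hp hpM
      have h2 : ∏ d ∈ M.divisors, Multiplicative.ofAdd ((p * d : ℕ) : ℤ) ^ moebius d =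
          Multiplicative.ofAdd (p * ∑ d ∈ M.divisors, moebius d * (d : ℤ)) := by
        rw [Finset.mul_sum, ofAdd_sum]
        refine Finset.prod_congr rfl fun d _ ↦ ?_
        rw [← ofAdd_zsmul, smul_eq_mul]
        push_cast
        ring_nf
      rw [key, key, h2, ← ofAdd_sub] at h
      rw [Multiplicative.ofAdd.injective h, Nat.totient_mul_of_prime_of_not_dvd hp hpM]
      have h3 : ∀ x : ℤ, x - p * x = -((p - 1) * x) := fun x ↦ by ring
      have h4 : (0 : ℤ) ≤ p - 1 := by have := hp.one_lt; omega
      rw [h3, abs_neg, abs_mul, abs_of_nonneg h4]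
      push_cast [hp.one_le]
      exact mul_le_mul_of_nonneg_left ih h4

/-! ### Fourier expansion of the eta product -/

local notation "𝕢" => Function.Periodic.qParam

lemma eta_natCast_mul (d : ℕ) (τ : ℂ) :
    ModularForm.eta (d * τ) =
      𝕢 24 τ ^ d * qPoch ((𝕢 24 τ ^ 24) ^ d) ((𝕢 24 τ ^ 24) ^ d) := by
  have h1 : 𝕢 24 (d * τ) = 𝕢 24 τ ^ d := by
    simp only [Function.Periodic.qParam, ← Complex.exp_nat_mul]
    ring_nf
  have h2 : 𝕢 1 (d * τ) = (𝕢 24 τ ^ 24) ^ d := by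
    simp only [Function.Periodic.qParam, ← Complex.exp_nat_mul]
    push_cast
    ring_nf
  rw [ModularForm.eta, h1, qPoch]
  simp only [ModularForm.eta_q, h2, pow_succ']

lemma saitoEtaProduct_eq (N : ℕ) (τ : ℍ) :
    saitoEtaProduct N τ =
      𝕢 24 τ ^ ((N * N.totient : ℤ) - ∑ d ∈ N.divisors, moebius d * (d : ℤ)) *
        etaSeries N (𝕢 24 τ ^ 24) := by
  have h0 : 𝕢 24 (τ : ℂ) ≠ 0 := Function.Periodic.qParam_ne_zero _
  have h1 : ∏ d ∈ N.divisors, (𝕢 24 (τ : ℂ) ^ d) ^ moebius d =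
      𝕢 24 (τ : ℂ) ^ ∑ d ∈ N.divisors, moebius d * (d : ℤ) := by
    rw [← prod_zpow_eq_zpow_sum h0]
    refine Finset.prod_congr rfl fun d _ ↦ ?_
    rw [← zpow_natCast, ← zpow_mul, mul_comm]
  simp only [saitoEtaProduct, eta_natCast_mul, mul_zpow, Finset.prod_mul_distrib, h1]
  rw [mul_pow, ← pow_mul, zpow_sub₀ h0, etaSeries, moebiusProd, div_mul_div_comm]
  congr 2

open UpperHalfPlane Function in
/-- The coefficients of a convergent expansion in powers of `𝕢 h` are those of the
`q`-expansion. -/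
lemma qExpansion_coeff_eq_of_hasSum {h : ℝ} (hh : 0 < h) {f : ℍ → ℂ} {c : ℕ → ℂ}
    (hf : ∀ τ : ℍ, HasSum (fun m ↦ c m • 𝕢 h (τ : ℂ) ^ m) (f τ)) (m : ℕ) :
    (qExpansion h f).coeff m = c m := by
  have hcusp : ∀ q : ℂ, ‖q‖ < 1 → q ≠ 0 →
      HasSum (fun m ↦ c m • q ^ m) (UpperHalfPlane.cuspFunction h f q) := by
    intro q hq hq0
    have h1 := Periodic.im_invQParam_pos_of_norm_lt_one hh hq hq0
    have h2 := hf ⟨Periodic.invQParam h q, h1⟩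
    have h3 : UpperHalfPlane.cuspFunction h f q = f ⟨Periodic.invQParam h q, h1⟩ := by
      rw [UpperHalfPlane.cuspFunction, Periodic.cuspFunction_eq_of_nonzero h _ hq0,
        Function.comp, ofComplex_apply_of_im_pos h1]
    rw [h3]
    simpa [Periodic.qParam_right_inv hh.ne' hq0] using h2
  -- The cusp function at 0 is defined as a limit, so its value there is first replaced by `c 0`;
  -- `hlim` then shows that nothing changed.
  have hser : HasFPowerSeriesOnBall (update (UpperHalfPlane.cuspFunction h f) 0 (c 0))
      (.ofScalars ℂ c) 0 1 := by
    refine ⟨le_of_forall_lt_imp_le_of_dense fun r hr ↦ ?_, by simp, fun {y} hy ↦ ?_⟩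
    · rcases eq_or_ne r 0 with rfl | hr'
      · simp
      · lift r to NNReal using hr.ne_top
        apply FormalMultilinearSeries.le_radius_of_summable
        simpa [smul_eq_mul, norm_mul, mul_comm, mul_left_comm, mul_assoc] using
          (hcusp (r : ℂ) (by simpa using hr) (mod_cast hr')).summable.norm
    · rw [← ENNReal.coe_one, Metric.eball_coe, NNReal.coe_one, mem_ball_zero_iff] at hy
      rcases eq_or_ne y 0 with rfl | hy'
      · simpa +contextual [zero_pow_eq] using hasSum_ite_eq 0 (c 0)
      · simpa [update_of_ne hy', mul_comm] using hcusp y hy hy'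
  have hlim : UpperHalfPlane.cuspFunction h f 0 = c 0 := by
    have h1 := hser.hasFPowerSeriesAt.continuousAt.tendsto
    rw [update_self] at h1
    rw [UpperHalfPlane.cuspFunction, Periodic.cuspFunction_zero_eq_limUnder_nhds_ne]
    refine (Tendsto.congr' ?_ (h1.mono_left nhdsWithin_le_nhds)).limUnder_eq
    filter_upwards [self_mem_nhdsWithin] with q hq using update_of_ne hq _ _
  rw [update_eq_self_iff.2 hlim.symm] at hser
  have hcoeff := congrArg (FormalMultilinearSeries.coeff · m)
    (hser.hasFPowerSeriesAt.eq_formalMultilinearSeries hser.analyticAt.hasFPowerSeriesAt)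
  simpa [qExpansion_coeff, div_eq_mul_inv, mul_comm] using hcoeff.symm

/-- For every `N ≥ 1` the eta product `S_N` has a Fourier expansion
`S_N(τ) = ∑_{m ≥ 0} c m * e^{2πiτm/24}`, valid on the whole upper half plane, whose coefficients
are the coefficients of its width-`24` expansion at infinity, and these are real and nonnegative. -/
theorem mainTheorem1 (N : ℕ) (hN : 0 < N) :
    ∃ c : ℕ → ℝ,
      (∀ m : ℕ, (UpperHalfPlane.qExpansion 24 (saitoEtaProduct N)).coeff m = (c m : ℂ)) ∧
      (∀ τ : ℍ, HasSum (fun m : ℕ ↦ (c m : ℂ) * Function.Periodic.qParam 24 (τ : ℂ) ^ m)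
        (saitoEtaProduct N τ)) ∧
      ∀ m : ℕ, 0 ≤ c m := by
  obtain ⟨e, he⟩ : ∃ e : ℕ, (N * N.totient : ℤ) - ∑ d ∈ N.divisors, moebius d * (d : ℤ) = e := by
    refine ⟨_, (Int.toNat_of_nonneg ?_).symm⟩
    have h1 := (le_abs_self _).trans (abs_sum_moebius_mul_le N hN.ne')
    have h2 : (N.totient : ℤ) ≤ N * N.totient := by
      exact_mod_cast Nat.le_mul_of_pos_left _ hN
    linarith
  have hpos : IsPosLaurent fun w ↦ w ^ (e : ℤ) * etaSeries N (w ^ 24) :=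
    (IsPosLaurent.zpow e).mul ((isPosLaurent_etaSeries hN.ne').comp_pow (by norm_num))
  have hlim : Tendsto (fun w : ℂ ↦ w ^ (e : ℤ) * etaSeries N (w ^ 24)) (𝓝 0) (𝓝 (0 ^ e * 1)) := by
    simp only [zpow_natCast]
    exact ((continuous_pow e).tendsto 0).mul ((tendsto_etaSeries hN.ne').comp
      (by simpa using (continuous_pow 24).tendsto (0 : ℂ)))
  have hbdd := (hlim.norm.eventually_le_const (lt_add_one _)).filter_mono
    (nhdsWithin_le_nhds (s := {0}ᶜ))
  obtain ⟨c, hc, hsum⟩ := hpos.exists_hasSum_pow hbdd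
  have hS : ∀ τ : ℍ, HasSum (fun m : ℕ ↦ (c m : ℂ) * 𝕢 24 (τ : ℂ) ^ m) (saitoEtaProduct N τ) :=
    fun τ ↦ by
      rw [saitoEtaProduct_eq, he]
      exact hsum _ (Function.Periodic.qParam_ne_zero _)
        (Function.Periodic.norm_qParam_lt_one (by norm_num) τ.im_pos)
  exact ⟨c, qExpansion_coeff_eq_of_hasSum (by norm_num) hS, hS, hc⟩
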